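/- Let $F=(f_1,\dots,f_m):\mathbb R^n\to\mathbb R^m$ ($m\ge 1$) be continuously differentiable. Write $u\le v$ for the componentwise order on $\mathbb R^m$ and $u\lneqq v$ if $u\le v$ and $u\ne v$; $x$ \emph{dominates} $y$ if $F(x)\lneqq F(y)$. For nonempty $I\subseteq\{1,\dots,m\}$ let $$\theta^I(x)=\min_{d\in\mathbb R^n}\Big(\max_{j\in I}\nabla f_j(x)^\top d+\tfrac12\|d\|^2\Big),$$ let $v^I(x)$ be the unique minimizer, and write $\theta,v$ for $\theta^I,v^I$ with $I=\{1,\dots,m\}$. Let $\mathcal D(x,d)=\max_{j}\nabla f_j(x)^\top d$ and, for a set $X$ of points, $\Theta(X)=\inf_{x\in X}\theta(x)$. \textbf{Front Descent.} Fix $\alpha_0>0$, $\delta,\gamma\in(0,1)$, $\Gamma_1,\Gamma_2>0$, thresholds $\sigma_k\ge 0$ and a finite set $X^0\subset\mathbb R^n$ of mutually nondominated points. Given $X^k$, set $\hat X=X^k$ and process the points $x\in X^k$ one after another. If $x\notin\hat X$ when its turn comes, skip it. Otherwise: (a) Refinement: if $\theta(x)<-\sigma_k$, take any direction $w$ that is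 a descent direction at $x$ for every $f_j$; let $d=w$ if $\mathcal D(x,w)\le-\Gamma_1\|v(x)\|^2$ and $\|w\|\le\Gamma_2\|v(x)\|$, and $d=v(x)$ otherwise; let $\alpha$ be the largest number of the form $\alpha_0\delta^h$, $h\in\mathbb N=\{0,1,2,\dots\}$, with $f_j(x+\alpha d)\le f_j(x)+\gamma\alpha\mathcal D(x,d)$ for all $j$, and put $z=x+\alpha d$. If $\theta(x)\ge-\sigma_k$, put $z=x$. Remove from $\hat X$ all points dominated by $z$ and add $z$. (b) Exploration: for each nonempty $I\subsetneq\{1,\dots,m\}$ with $\theta^I(z)<0$, one after another, if $z\in\hat X$ at that moment, let $\alpha$ be the largest number of the form $\alpha_0\delta^h$, $h\in\mathbb N$, such that for every $y\in\hat X$ there is $j$ with $f_j(z+\alpha v^I(z))<f_j(y)$; remove from $\hat X$ all points dominated by $z+\alpha v^I(z)$ and add $z+\alpha v^I(z)$. When all points of $X^k$ have been processed, set $X^{k+1}=\hat X$. \textbf{Theorem.} Suppose that there is $x_0\in X^0$ such that $\mathcal L(x_0)=\bigcup_{j=1}^m\{x\in\mathbb R^n: f_j(x)\le f_j(x_0)\}$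 is compact, and that at each iteration $k$ the first processed point of $X^k$ minimizes $\theta$ over $X^k$. Then every sequence $\{X^k\}_{k\ge0}$ produced by Front Descent (run without stopping) satisfies: (i) if $\sigma_k=\sigma>0$ for all $k$, then there is $\bar k$ such that $\Theta(X^k)\ge-\sigma$ for all $k\ge\bar k$; (ii) if $\sigma_k\to0$, then $\lim_{k\to\infty}\Theta(X^k)=0$. -/

import Mathlib

namespace FrontDescent

/-- The decision space `ℝⁿ` with its Euclidean structure. -/
abbrev Pt (n : ℕ) : Type := EuclideanSpace ℝ (Fin n)

noncomputable section

variable {n m : ℕ}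

/-- `x` dominates `y`: `F x ≤ F y` componentwise and `F x ≠ F y`. -/
def Dominates (F : Pt n → Fin m → ℝ) (x y : Pt n) : Prop :=
  F x ≤ F y ∧ F x ≠ F y

/-- A set of mutually nondominated points. -/
def MutuallyNondominated (F : Pt n → Fin m → ℝ) (X : Set (Pt n)) : Prop :=
  ∀ x ∈ X, ∀ y ∈ X, ¬ Dominates F x y

/-- The set `⋃ⱼ {x | fⱼ(x) ≤ fⱼ(x₀)}`. -/
def levelSet (F : Pt n → Fin m → ℝ) (x₀ : Pt n) : Set (Pt n) :=
  ⋃ j : Fin m, {x | F x j ≤ F x₀ j}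

/-- `max_{j ∈ I} ∇fⱼ(x)ᵀ d` (used for nonempty `I` only). -/
def maxSlope (F : Pt n → Fin m → ℝ) (I : Finset (Fin m)) (x d : Pt n) : ℝ :=
  ⨆ j : I, inner ℝ (gradient (fun y => F y j) x) d

/-- The objective `max_{j ∈ I} ∇fⱼ(x)ᵀ d + ½ ‖d‖²` of the steepest descent problem. -/
def steepestObj (F : Pt n → Fin m → ℝ) (I : Finset (Fin m)) (x d : Pt n) : ℝ :=
  maxSlope F I x d + 1 / 2 * ‖d‖ ^ 2

theorem continuous_maxSlope (F : Pt n → Fin m → ℝ) (I : Finset (Fin m)) (x : Pt n) :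
    Continuous (maxSlope F I x) := by
  unfold maxSlope
  rcases isEmpty_or_nonempty I with h | h
  · simp only [Real.iSup_of_isEmpty]
    exact continuous_const
  · simp only [← Finset.sup'_univ_eq_ciSup]
    exact Continuous.finset_sup'_apply _ fun j _ => by fun_prop

theorem exists_neg_mul_norm_le_maxSlope (F : Pt n → Fin m → ℝ) (I : Finset (Fin m))
    (x : Pt n) : ∃ C : ℝ, ∀ d, -(C * ‖d‖) ≤ maxSlope F I x d := by
  rcases isEmpty_or_nonempty I with h | ⟨⟨j⟩⟩
  · exact ⟨0, fun d => by simp [maxSlope, Real.iSup_of_isEmpty]⟩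
  · refine ⟨‖gradient (fun y => F y j) x‖, fun d => ?_⟩
    have h1 : inner ℝ (gradient (fun y => F y j) x) d ≤ maxSlope F I x d :=
      le_ciSup (f := fun j : I => inner ℝ (gradient (fun y => F y j) x) d)
        (Set.finite_range _).bddAbove j
    have h2 := (abs_le.1 (abs_real_inner_le_norm (gradient (fun y => F y j) x) d)).1
    linarith

/-- The steepest descent problem has a solution. -/
theorem exists_isMinOn_steepestObj (F : Pt n → Fin m → ℝ) (I : Finset (Fin m)) (x : Pt n) :
    ∃ d, IsMinOn (steepestObj F I x) Set.univ d := by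
  obtain ⟨C, hC⟩ := exists_neg_mul_norm_le_maxSlope F I x
  have hcont : Continuous (steepestObj F I x) := by
    have := continuous_maxSlope F I x
    unfold steepestObj
    fun_prop
  have hlim : Filter.Tendsto (steepestObj F I x) (Filter.cocompact _) Filter.atTop := by
    have h1 : Filter.Tendsto (fun d : Pt n => ‖d‖) (Filter.cocompact _) Filter.atTop :=
      tendsto_norm_cocompact_atTop
    refine Filter.tendsto_atTop_mono' _ ?_ h1
    filter_upwards [h1.eventually_ge_atTop (2 * (C + 1)), h1.eventually_ge_atTop 0] with d hd hd0
    have := hC d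
    unfold steepestObj
    nlinarith [mul_nonneg hd0 (sub_nonneg.2 hd)]
  obtain ⟨d, hd⟩ := hcont.exists_forall_le hlim
  exact ⟨d, fun y _ => hd y⟩

/-- The steepest descent direction `v^I(x)`: the minimizer of `steepestObj F I x`, which exists by
the preceding theorem and is unique by strong convexity. -/
def steepestDir (F : Pt n → Fin m → ℝ) (I : Finset (Fin m)) (x : Pt n) : Pt n :=
  (exists_isMinOn_steepestObj F I x).choose

/-- The optimal value `θ^I(x)` of the steepest descent problem. -/
def thetaI (F : Pt n → Fin m → ℝ) (I : Finset (Fin m)) (x : Pt n) : ℝ :=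
  ⨅ d : Pt n, steepestObj F I x d

/-- `𝒟(x, d) = maxⱼ ∇fⱼ(x)ᵀ d`. -/
def slope (F : Pt n → Fin m → ℝ) (x d : Pt n) : ℝ := maxSlope F Finset.univ x d

/-- The steepest common descent direction `v(x)`. -/
def v (F : Pt n → Fin m → ℝ) (x : Pt n) : Pt n := steepestDir F Finset.univ x

/-- The stationarity measure `θ(x)`. -/
def theta (F : Pt n → Fin m → ℝ) (x : Pt n) : ℝ := thetaI F Finset.univ x

/-- The set-stationarity measure `Θ(X) = inf_{x ∈ X} θ(x)`. -/
def Theta (F : Pt n → Fin m → ℝ) (X : Set (Pt n)) : ℝ := sInf (theta F '' X)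

/-- `d` is a descent direction for every objective at `x`. -/
def IsCommonDescentDir (F : Pt n → Fin m → ℝ) (x d : Pt n) : Prop :=
  ∀ j, ∃ τ > 0, ∀ t, 0 < t → t ≤ τ → F (x + t • d) j < F x j

/-- The scalar input parameters of the algorithm. -/
structure Params where
  α₀ : ℝ
  δ : ℝ
  γ : ℝ
  Γ₁ : ℝ
  Γ₂ : ℝ
  α₀_pos : 0 < α₀
  δ_pos : 0 < δ
  δ_lt_one : δ < 1
  γ_pos : 0 < γ
  γ_lt_one : γ < 1
  Γ₁_pos : 0 < Γ₁
  Γ₂_pos : 0 < Γ₂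

/-- The trial steps `α₀ δ^h` satisfying the Armijo condition for all objectives. -/
def armijoSteps (F : Pt n → Fin m → ℝ) (p : Params) (x d : Pt n) : Set ℝ :=
  {α | (∃ h : ℕ, α = p.α₀ * p.δ ^ h) ∧
    ∀ j, F (x + α • d) j ≤ F x j + p.γ * α * slope F x d}

/-- The trial steps `α₀ δ^h` accepted by the exploration line search from `z` along `v^I(z)`,
the current list being `Y`. -/
def explorationSteps (F : Pt n → Fin m → ℝ) (p : Params) (Y : Set (Pt n)) (z : Pt n)
    (I : Finset (Fin m)) : Set ℝ :=
  {α | (∃ h : ℕ, α = p.α₀ * p.δ ^ h) ∧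
    ∀ y ∈ Y, ∃ j, F (z + α • steepestDir F I z) j < F y j}

/-- Remove from `Y` the points dominated by `z`, then add `z`. -/
def insertFilter (F : Pt n → Fin m → ℝ) (Y : Set (Pt n)) (z : Pt n) : Set (Pt n) :=
  (Y \ {y ∈ Y | Dominates F z y}) ∪ {z}

/-- The safeguard: `w` is steepest-descent-related at `x`. -/
def Safeguard (F : Pt n → Fin m → ℝ) (p : Params) (x w : Pt n) : Prop :=
  slope F x w ≤ -p.Γ₁ * ‖v F x‖ ^ 2 ∧ ‖w‖ ≤ p.Γ₂ * ‖v F x‖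

/-- `z` is a possible outcome of the refinement step at `x` with threshold `σ`; `w` is the
tentative common descent direction, which may be chosen arbitrarily. -/
def Refine (F : Pt n → Fin m → ℝ) (p : Params) (σ : ℝ) (x z : Pt n) : Prop :=
  (theta F x < -σ ∧ ∃ w d : Pt n, ∃ α : ℝ, IsCommonDescentDir F x w ∧
      ((Safeguard F p x w ∧ d = w) ∨ (¬ Safeguard F p x w ∧ d = v F x)) ∧
      IsGreatest (armijoSteps F p x d) α ∧ z = x + α • d) ∨
  (¬ theta F x < -σ ∧ z = x)

/-- A `for` loop over the list, in the order of the list: `R a Y Y'` says that the body executed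
for `a` may turn the state `Y` into the state `Y'`. -/
def ForLoop {A S : Type} (R : A → S → S → Prop) : List A → S → S → Prop
  | [], Y, Y' => Y' = Y
  | a :: l, Y, Y' => ∃ Y₁, R a Y Y₁ ∧ ForLoop R l Y₁ Y'

/-- Body of the exploration loop from `z`, for the subset `I` of objectives. -/
def Explore (F : Pt n → Fin m → ℝ) (p : Params) (z : Pt n) (I : Finset (Fin m))
    (Y Y' : Set (Pt n)) : Prop :=
  (z ∈ Y ∧ ∃ α : ℝ, IsGreatest (explorationSteps F p Y z I) α ∧
      Y' = insertFilter F Y (z + α • steepestDir F I z)) ∨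
  (z ∉ Y ∧ Y' = Y)

/-- Body of the main loop for the point `x`: refinement, then exploration over all nonempty proper
subsets `I` of objectives with `θ^I(z) < 0`, in some order. -/
def PointUpdate (F : Pt n → Fin m → ℝ) (p : Params) (σ : ℝ) (x : Pt n) (Y Y' : Set (Pt n)) : Prop :=
  (x ∈ Y ∧ ∃ (z : Pt n) (Is : List (Finset (Fin m))), Refine F p σ x z ∧ Is.Nodup ∧
      (∀ I, I ∈ Is ↔ I.Nonempty ∧ I ⊂ Finset.univ ∧ thetaI F I z < 0) ∧
      ForLoop (Explore F p z) Is (insertFilter F Y z) Y') ∨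
  (x ∉ Y ∧ Y' = Y)

/-- `X 0, X 1, …` is produced by the Front Descent algorithm with thresholds `σ k`, where `L k`
lists the points of `X k` in the order in which iteration `k` visits them. -/
def IsFrontDescentRun (F : Pt n → Fin m → ℝ) (p : Params) (σ : ℕ → ℝ) (X : ℕ → Set (Pt n))
    (L : ℕ → List (Pt n)) : Prop :=
  ∀ k, (L k).Nodup ∧ (∀ x, x ∈ L k ↔ x ∈ X k) ∧
    ForLoop (PointUpdate F p (σ k)) (L k) (X k) (X (k + 1))

/-- At each iteration the first processed point minimizes `θ` over the current set. -/
def FirstMinimizesTheta (F : Pt n → Fin m → ℝ) (X : ℕ → Set (Pt n))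
    (L : ℕ → List (Pt n)) : Prop :=
  ∀ k, ∀ x ∈ (L k).head?, x ∈ X k ∧ IsMinOn (theta F) (X k) x

end

end FrontDescent

namespace FrontDescent

open Filter Topology

variable {n m : ℕ}

/-! Two invariants carry the proof. Every list stays mutually nondominated, and a point once covered
(weakly bettered in all objectives by a listed point) stays covered. Since `x₀` is covered, no
listed point is worse than it in every objective, so all lists lie in the compact level set. There,
refinement at a point with `θ < -ε` and `θ < -σ` lowers all objectives by at least a uniform `η > 0`
(`exists_refine_decrease`). If iterations `k < l` both start from such points `x`, `x'`, the
refinement of `x` is still covered at `l`, so some objective satisfies `f_j(x') ≤ f_j(x) - η`. Their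
images are thus `η`-separated, and the compact image of the level set allows only finitely many.
Both claims follow from this finiteness (`eventually_not_lt`). -/

theorem ForLoop.preserves {A S : Type} {R : A → S → S → Prop} {P : S → Prop}
    (hR : ∀ a Y Y', R a Y Y' → P Y → P Y') :
    ∀ (l : List A) (Y Y' : S), ForLoop R l Y Y' → P Y → P Y'
  | [], Y, Y', h, hY => by
    have h' : Y' = Y := h
    exact h' ▸ hY
  | a :: l, Y, Y', h, hY => by
    obtain ⟨Y₁, h₁, h₂⟩ := h
    exact ForLoop.preserves hR l Y₁ Y' h₂ (hR a Y Y₁ h₁ hY)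

/-! ### Invariants of the list: coverage and mutual nondominance -/

theorem mem_insertFilter {F : Pt n → Fin m → ℝ} {Y : Set (Pt n)} {z y : Pt n} :
    y ∈ insertFilter F Y z ↔ (y ∈ Y ∧ ¬ Dominates F z y) ∨ y = z := by
  simp only [insertFilter, Set.mem_union, Set.mem_sdiff, Set.mem_ofPred_eq,
    Set.mem_singleton_iff]
  tauto

/-- Some point of `Y` is at least as good as `u` in all objectives. -/
def Covers (F : Pt n → Fin m → ℝ) (u : Pt n) (Y : Set (Pt n)) : Prop :=
  ∃ y ∈ Y, F y ≤ F u

theorem Covers.of_mem {F : Pt n → Fin m → ℝ} {u : Pt n} {Y : Set (Pt n)} (h : u ∈ Y) :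
    Covers F u Y := ⟨u, h, le_rfl⟩

/-- A covering point is removed only when `z` dominates it, and then `z` covers by transitivity. -/
theorem Covers.insertFilter {F : Pt n → Fin m → ℝ} {u : Pt n} {Y : Set (Pt n)}
    (h : Covers F u Y) (z : Pt n) : Covers F u (insertFilter F Y z) := by
  obtain ⟨y, hy, hyu⟩ := h
  by_cases hd : Dominates F z y
  · exact ⟨z, mem_insertFilter.2 (Or.inr rfl), hd.1.trans hyu⟩
  · exact ⟨y, mem_insertFilter.2 (Or.inl ⟨hy, hd⟩), hyu⟩

theorem MutuallyNondominated.insertFilter {F : Pt n → Fin m → ℝ} {Y : Set (Pt n)}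
    (h : MutuallyNondominated F Y) {z : Pt n} (hz : ∀ y ∈ Y, ¬ Dominates F y z) :
    MutuallyNondominated F (insertFilter F Y z) := by
  intro a ha b hb
  rcases mem_insertFilter.1 ha with ⟨haY, -⟩ | rfl
  · rcases mem_insertFilter.1 hb with ⟨hbY, -⟩ | rfl
    · exact h a haY b hbY
    · exact hz a haY
  · rcases mem_insertFilter.1 hb with ⟨-, hb⟩ | rfl
    · exact hb
    · exact fun hd => hd.2 rfl

theorem Covers.explore {F : Pt n → Fin m → ℝ} {p : Params} {u z : Pt n} (I : Finset (Fin m))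
    (Y Y' : Set (Pt n)) (h : Explore F p z I Y Y') (hY : Covers F u Y) : Covers F u Y' := by
  rcases h with ⟨-, α, -, rfl⟩ | ⟨-, rfl⟩
  · exact hY.insertFilter _
  · exact hY

theorem MutuallyNondominated.explore {F : Pt n → Fin m → ℝ} {p : Params} {z : Pt n}
    (I : Finset (Fin m)) (Y Y' : Set (Pt n)) (h : Explore F p z I Y Y')
    (hY : MutuallyNondominated F Y) : MutuallyNondominated F Y' := by
  rcases h with ⟨-, α, hα, rfl⟩ | ⟨-, rfl⟩
  · refine hY.insertFilter fun y hy hd => ?_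
    obtain ⟨j, hj⟩ := hα.1.2 y hy
    exact absurd (hd.1 j) (not_le.2 hj)
  · exact hY

theorem Covers.pointUpdate {F : Pt n → Fin m → ℝ} {p : Params} {σ : ℝ} {u : Pt n} (x : Pt n)
    (Y Y' : Set (Pt n)) (h : PointUpdate F p σ x Y Y') (hY : Covers F u Y) : Covers F u Y' := by
  rcases h with ⟨-, z, Is, -, -, -, hloop⟩ | ⟨-, rfl⟩
  · exact ForLoop.preserves Covers.explore Is _ _ hloop (hY.insertFilter z)
  · exact hY

/-! ### The steepest descent problem and its optimal value -/

section Slope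

variable {F : Pt n → Fin m → ℝ}

theorem inner_gradient_eq (hF : ContDiff ℝ 1 F) (x d : Pt n) (j : Fin m) :
    inner ℝ (gradient (fun y => F y j) x) d = fderiv ℝ F x d j := by
  have hd : DifferentiableAt ℝ F x := (hF.differentiable one_ne_zero) x
  have h1 : HasFDerivAt (fun y => F y j)
      ((ContinuousLinearMap.proj (R := ℝ) (φ := fun _ : Fin m => ℝ) j).comp (fderiv ℝ F x)) x :=
    (ContinuousLinearMap.proj (R := ℝ) (φ := fun _ : Fin m => ℝ) j).hasFDerivAt.comp x
      hd.hasFDerivAt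
  rw [gradient, InnerProductSpace.toDual_symm_apply, h1.fderiv]
  rfl

theorem fderiv_apply_le_slope (hF : ContDiff ℝ 1 F) (x d : Pt n) (j : Fin m) :
    fderiv ℝ F x d j ≤ slope F x d := by
  rw [← inner_gradient_eq hF]
  exact le_ciSup
    (f := fun j : (Finset.univ : Finset (Fin m)) => inner ℝ (gradient (fun y => F y j) x) d)
    (Set.finite_range _).bddAbove ⟨j, Finset.mem_univ j⟩

theorem slope_smul (x d : Pt n) {t : ℝ} (ht : 0 ≤ t) :
    slope F x (t • d) = t * slope F x d := by
  simp only [slope, maxSlope, inner_smul_right]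
  exact (Real.mul_iSup_of_nonneg ht _).symm

theorem theta_eq_steepestObj_v (x : Pt n) :
    theta F x = slope F x (v F x) + 1 / 2 * ‖v F x‖ ^ 2 := by
  have h : ∀ d, steepestObj F Finset.univ x (v F x) ≤ steepestObj F Finset.univ x d :=
    fun d => (exists_isMinOn_steepestObj F Finset.univ x).choose_spec (Set.mem_univ d)
  exact le_antisymm (ciInf_le ⟨_, Set.forall_mem_range.2 h⟩ (v F x)) (le_ciInf h)

theorem theta_le (x d : Pt n) : theta F x ≤ slope F x d + 1 / 2 * ‖d‖ ^ 2 := by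
  rw [theta_eq_steepestObj_v]
  exact (exists_isMinOn_steepestObj F Finset.univ x).choose_spec (Set.mem_univ d)

theorem theta_nonpos (x : Pt n) : theta F x ≤ 0 := by
  have h := theta_le (F := F) x ((0 : ℝ) • 0)
  rw [slope_smul x 0 le_rfl] at h
  simpa using h

/-- Along the ray `t • v`, `t ≥ 0`, the objective is `t * D + t ^ 2 * q / 2`, which must be minimal
at `t = 1`; stationarity there gives `D = -q`. -/
theorem slope_v (x : Pt n) : slope F x (v F x) = -‖v F x‖ ^ 2 := by
  set D := slope F x (v F x)
  set q := ‖v F x‖ ^ 2 with hq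
  have hq0 : 0 ≤ q := sq_nonneg _
  have key : ∀ t : ℝ, 0 ≤ t → D + 1 / 2 * q ≤ t * D + 1 / 2 * (t ^ 2 * q) := by
    intro t ht
    have h := theta_le (F := F) x (t • v F x)
    rw [slope_smul x _ ht, theta_eq_steepestObj_v, norm_smul, mul_pow, Real.norm_eq_abs,
      sq_abs] at h
    exact h
  rcases hq0.eq_or_lt with h0 | hpos
  · have h1 := key 0 le_rfl
    have h2 := key 2 zero_le_two
    linarith
  · have h0 := key 0 le_rfl
    -- The vertex of the parabola; it is admissible because `h0` forces `D ≤ 0`.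
    have h1 := key (-D / q) (div_nonneg (by linarith) hpos.le)
    have h2 : -D / q * D + 1 / 2 * ((-D / q) ^ 2 * q) = -(D ^ 2 / q) / 2 := by
      field_simp
      ring
    rw [h2] at h1
    have h3 : D ^ 2 / q * q = D ^ 2 := div_mul_cancel₀ _ hpos.ne'
    have h4 : (D + q) ^ 2 ≤ 0 := by nlinarith
    have h5 : D + q = 0 := by
      rwa [← sq_eq_zero_iff, ← (sq_nonneg (D + q)).ge_iff_eq']
    linarith

theorem theta_eq_neg_half_sq (x : Pt n) : theta F x = -(1 / 2 * ‖v F x‖ ^ 2) := by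
  rw [theta_eq_steepestObj_v, slope_v]
  ring

theorem norm_v_le (hm : 0 < m) (hF : ContDiff ℝ 1 F) (x : Pt n) :
    ‖v F x‖ ≤ ‖fderiv ℝ F x‖ := by
  have h1 := fderiv_apply_le_slope hF x (v F x) ⟨0, hm⟩
  rw [slope_v] at h1
  have h2 := (norm_le_pi_norm (fderiv ℝ F x (v F x)) ⟨0, hm⟩).trans
    ((fderiv ℝ F x).le_opNorm (v F x))
  rw [Real.norm_eq_abs] at h2
  have h3 := (abs_le.1 h2).1
  rcases (norm_nonneg (v F x)).eq_or_lt with h0 | hpos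
  · rw [← h0]
    exact norm_nonneg _
  · nlinarith

end Slope

/-! ### Refinement: monotonicity and uniform decrease -/

theorem Refine.le {F : Pt n → Fin m → ℝ} {p : Params} {σ : ℝ} {x z : Pt n}
    (h : Refine F p σ x z) : F z ≤ F x := by
  rcases h with ⟨-, w, d, α, hw, hd, hα, rfl⟩ | ⟨-, rfl⟩
  · intro j
    obtain ⟨⟨h, rfl⟩, hj⟩ := hα.1
    have hs : slope F x d ≤ 0 := by
      rcases hd with ⟨hs, rfl⟩ | ⟨-, rfl⟩
      · have := hs.1
        nlinarith [mul_nonneg p.Γ₁_pos.le (sq_nonneg ‖v F x‖)]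
      · rw [slope_v]
        nlinarith [sq_nonneg ‖v F x‖]
    have hpos : 0 ≤ p.γ * (p.α₀ * p.δ ^ h) :=
      mul_nonneg p.γ_pos.le (mul_nonneg p.α₀_pos.le (pow_nonneg p.δ_pos.le h))
    nlinarith [hj j, mul_nonneg hpos (neg_nonneg.2 hs)]
  · exact le_rfl

theorem MutuallyNondominated.pointUpdate {F : Pt n → Fin m → ℝ} {p : Params} {σ : ℝ}
    (x : Pt n) (Y Y' : Set (Pt n))
    (h : PointUpdate F p σ x Y Y') (hY : MutuallyNondominated F Y) :
    MutuallyNondominated F Y' := by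
  rcases h with ⟨hx, z, Is, hz, -, -, hloop⟩ | ⟨-, rfl⟩
  -- If `y` dominated `z`, then `F y ≤ F z ≤ F x`; as `y` does not dominate `x`, equality holds
  -- throughout, contradicting `F y ≠ F z`.
  · refine ForLoop.preserves MutuallyNondominated.explore Is _ _ hloop
      (hY.insertFilter fun y hy hd => hY y hy x hx ⟨hd.1.trans (hz.le), fun he => hd.2 ?_⟩)
    exact le_antisymm hd.1 (he ▸ hz.le)
  · exact hY

/-- Uniform Armijo acceptance: over a compact set, all sufficiently short steps along bounded
directions of uniformly negative slope satisfy the sufficient decrease condition. -/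
theorem exists_armijo_threshold {F : Pt n → Fin m → ℝ} (hF : ContDiff ℝ 1 F) {K : Set (Pt n)}
    (hK : IsCompact K) {γ c R : ℝ} (hγ : γ < 1) (hc : 0 < c) (hR : 0 < R) :
    ∃ a > 0, ∀ x ∈ K, ∀ d : Pt n, ‖d‖ ≤ R → slope F x d ≤ -c → ∀ α, 0 ≤ α → α ≤ a →
      ∀ j, F (x + α • d) j ≤ F x j + γ * α * slope F x d := by
  -- Slope at most `-c` leaves slack `(1 - γ) * c` in the Armijo test; this tolerance on the
  -- derivative keeps the linearization error per unit step within it.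
  have hC : 0 < (1 - γ) * c / R := div_pos (mul_pos (sub_pos.2 hγ) hc) hR
  set C := (1 - γ) * c / R with hCdef
  have hcont : Continuous (fderiv ℝ F) := hF.continuous_fderiv one_ne_zero
  -- Only the base point must lie in `K`: the trial points may leave it.
  have hunif := hK.uniformContinuousAt_of_continuousAt (fderiv ℝ F)
    (fun x _ => hcont.continuousAt) (Metric.dist_mem_uniformity hC)
  obtain ⟨r, hr, hrC⟩ := Metric.mem_uniformity_dist.1 hunif
  refine ⟨r / (2 * R), by positivity, fun x hx d hd hs α hα0 hαa j => ?_⟩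
  have hlt : ‖α • d‖ < r := by
    rw [norm_smul, Real.norm_of_nonneg hα0]
    calc α * ‖d‖ ≤ r / (2 * R) * R := by gcongr
      _ = r / 2 := by field_simp
      _ < r := by linarith
  have hmv : ‖F (x + α • d) - F x - fderiv ℝ F x ((x + α • d) - x)‖ ≤ C * ‖(x + α • d) - x‖ := by
    refine (convex_ball x r).norm_image_sub_le_of_norm_hasFDerivWithin_le' (𝕜 := ℝ)
      (f' := fderiv ℝ F)
      (fun y _ => ((hF.differentiable one_ne_zero) y).hasFDerivAt.hasFDerivWithinAt)
      (fun y hy => ?_) (Metric.mem_ball_self hr) (by simpa [dist_eq_norm] using hlt)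
    have h1 := hrC (a := x) (b := y) (by rwa [dist_comm]) hx
    have h2 : dist (fderiv ℝ F x) (fderiv ℝ F y) < C := h1
    rw [← dist_eq_norm, dist_comm]
    exact h2.le
  rw [add_sub_cancel_left, map_smul, norm_smul, Real.norm_of_nonneg hα0] at hmv
  have hj := (le_abs_self _).trans ((norm_le_pi_norm _ j).trans hmv)
  simp only [Pi.sub_apply, Pi.smul_apply, smul_eq_mul] at hj
  have hsl := fderiv_apply_le_slope hF x d j
  have hCR : C * ‖d‖ ≤ (1 - γ) * c := by
    calc C * ‖d‖ ≤ C * R := by gcongr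
      _ = (1 - γ) * c := by rw [hCdef]; field_simp
  have h1 : fderiv ℝ F x d j + C * ‖d‖ ≤ γ * slope F x d := by nlinarith
  nlinarith [mul_le_mul_of_nonneg_left h1 hα0]

/-- Refinement at points of a compact set where `θ < -ε` decreases all objectives by a uniform
amount. -/
theorem exists_refine_decrease {F : Pt n → Fin m → ℝ} (hm : 0 < m) (hF : ContDiff ℝ 1 F)
    (p : Params) {K : Set (Pt n)} (hK : IsCompact K) {ε : ℝ} (hε : 0 < ε) :
    ∃ η > 0, ∀ x ∈ K, ∀ z σ, theta F x < -ε → theta F x < -σ → Refine F p σ x z →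
      ∀ j, F z j ≤ F x j - η := by
  obtain ⟨G, hG⟩ := hK.exists_bound_of_continuousOn
    (hF.continuous_fderiv one_ne_zero).continuousOn
  set G' := max G 1
  -- The factor `1` in the max and min accounts for the fallback `d = v`, the constants `Γ₂` and
  -- `Γ₁` for a safeguarded `w`.
  set R := max 1 p.Γ₂ * G'
  set c := min 1 p.Γ₁ * (2 * ε)
  have hG' : 0 < G' := lt_max_of_lt_right one_pos
  have hR : 0 < R := mul_pos (lt_max_of_lt_left one_pos) hG'
  have hmin : 0 < min 1 p.Γ₁ := lt_min one_pos p.Γ₁_pos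
  have hc : 0 < c := mul_pos hmin (by positivity)
  obtain ⟨a, ha, hstep⟩ := exists_armijo_threshold hF hK p.γ_lt_one hc hR
  obtain ⟨N, hN⟩ := exists_pow_lt_of_lt_one (div_pos ha p.α₀_pos) p.δ_lt_one
  have hNa : p.α₀ * p.δ ^ N ≤ a := by
    rw [mul_comm]
    exact ((lt_div_iff₀ p.α₀_pos).1 hN).le
  have hNpos : 0 < p.α₀ * p.δ ^ N := mul_pos p.α₀_pos (pow_pos p.δ_pos N)
  refine ⟨p.γ * (p.α₀ * p.δ ^ N) * c, mul_pos (mul_pos p.γ_pos hNpos) hc, ?_⟩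
  intro x hx z σ hθε hθσ href j
  rcases href with ⟨-, w, d, α, -, hd, hα, rfl⟩ | ⟨hn, -⟩
  swap
  · exact absurd hθσ hn
  have hv : 2 * ε ≤ ‖v F x‖ ^ 2 := by
    rw [theta_eq_neg_half_sq] at hθε
    linarith
  have hvG : ‖v F x‖ ≤ G' := (norm_v_le hm hF x).trans ((hG x hx).trans (le_max_left _ _))
  have hcv : ∀ b, min 1 p.Γ₁ ≤ b → -b * ‖v F x‖ ^ 2 ≤ -c := by
    intro b hb
    have : c ≤ b * ‖v F x‖ ^ 2 :=
      mul_le_mul hb hv (by positivity) (hmin.le.trans hb)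
    linarith
  have hRv : ∀ b, b ≤ max 1 p.Γ₂ → b * ‖v F x‖ ≤ R := by
    intro b hb
    exact mul_le_mul hb hvG (norm_nonneg _) (zero_le_one.trans (le_max_left _ _))
  obtain ⟨hdR, hdc⟩ : ‖d‖ ≤ R ∧ slope F x d ≤ -c := by
    rcases hd with ⟨hs, rfl⟩ | ⟨-, rfl⟩
    · exact ⟨hs.2.trans (hRv _ (le_max_right _ _)), hs.1.trans (hcv _ (min_le_right _ _))⟩
    · refine ⟨by simpa using hRv 1 (le_max_left _ _), ?_⟩
      rw [slope_v]
      simpa using hcv 1 (min_le_left _ _)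
  -- The line search takes the largest admissible step, so it never falls below this fixed one.
  have hle : p.α₀ * p.δ ^ N ≤ α :=
    hα.2 ⟨⟨N, rfl⟩, hstep x hx d hdR hdc _ hNpos.le hNa⟩
  have hdec := hα.1.2 j
  have h1 : p.γ * (p.α₀ * p.δ ^ N) * c ≤ p.γ * α * c := by
    have := p.γ_pos.le
    gcongr
  have h2 : p.γ * α * slope F x d ≤ p.γ * α * (-c) :=
    mul_le_mul_of_nonneg_left hdc (mul_nonneg p.γ_pos.le (hNpos.le.trans hle))
  linarith

/-- A point of a nondominated set that covers `u` cannot be worse than `u` in all objectives. -/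
theorem MutuallyNondominated.exists_le_of_covers {F : Pt n → Fin m → ℝ} {Y : Set (Pt n)}
    (hm : 0 < m) (hY : MutuallyNondominated F Y) {u x : Pt n} (hu : Covers F u Y) (hx : x ∈ Y) :
    ∃ j, F x j ≤ F u j := by
  obtain ⟨y, hy, hyu⟩ := hu
  by_contra! h
  refine hY y hy x hx ⟨fun j => (hyu j).trans (h j).le, fun he => ?_⟩
  have h1 := h ⟨0, hm⟩
  rw [← he] at h1
  exact absurd (hyu ⟨0, hm⟩) (not_le.2 h1)

/-- A sequence in a compact set has two terms, with increasing indices, that are arbitrarily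
close. -/
theorem exists_lt_dist_lt {E : Type*} [PseudoMetricSpace E] {K : Set E} (hK : IsCompact K)
    {u : ℕ → E} (hu : ∀ i, u i ∈ K) {η : ℝ} (hη : 0 < η) : ∃ i j, i < j ∧ dist (u i) (u j) < η := by
  obtain ⟨a, -, ψ, hψ, hlim⟩ := hK.tendsto_subseq hu
  obtain ⟨N, hN⟩ := Metric.cauchySeq_iff.1 hlim.cauchySeq η hη
  exact ⟨ψ N, ψ (N + 1), hψ N.lt_succ_self, hN N le_rfl (N + 1) N.le_succ⟩

/-! ### Finiteness of the bad iterations along a run -/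

section Run

variable {F : Pt n → Fin m → ℝ} {p : Params} {σ : ℕ → ℝ} {X : ℕ → Set (Pt n)}
  {L : ℕ → List (Pt n)}

theorem IsFrontDescentRun.mutuallyNondominated (hrun : IsFrontDescentRun F p σ X L)
    (h₀ : MutuallyNondominated F (X 0)) (k : ℕ) :
    MutuallyNondominated F (X k) := by
  induction k with
  | zero => exact h₀
  | succ k ih =>
    exact ForLoop.preserves MutuallyNondominated.pointUpdate _ _ _ (hrun k).2.2 ih

theorem IsFrontDescentRun.covers (hrun : IsFrontDescentRun F p σ X L) {u : Pt n} {k l : ℕ}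
    (hkl : k ≤ l) (h : Covers F u (X k)) : Covers F u (X l) := by
  induction l, hkl using Nat.le_induction with
  | base => exact h
  | succ l _ ih => exact ForLoop.preserves Covers.pointUpdate _ _ _ (hrun l).2.2 ih

/-- The first processed point realizes `Θ`, and its refinement is covered at the next
iteration. -/
theorem IsFrontDescentRun.exists_first (hrun : IsFrontDescentRun F p σ X L)
    (horder : FirstMinimizesTheta F X L) {k : ℕ} (hne : (X k).Nonempty) :
    ∃ x ∈ X k, Theta F (X k) = theta F x ∧
      ∃ z, Refine F p (σ k) x z ∧ Covers F z (X (k + 1)) := by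
  obtain ⟨-, hmem, hloop⟩ := hrun k
  have hord := horder k
  rcases hL : L k with _ | ⟨x, l⟩
  · obtain ⟨y, hy⟩ := hne
    simpa [hL] using (hmem y).2 hy
  · rw [hL] at hloop hord
    obtain ⟨hx, hmin⟩ := hord x rfl
    obtain ⟨Y₁, hupd, hrest⟩ := hloop
    refine ⟨x, hx, ?_, ?_⟩
    · exact IsLeast.csInf_eq ⟨⟨x, hx, rfl⟩, Set.forall_mem_image.2 fun y hy => hmin hy⟩
    · rcases hupd with ⟨-, z, Is, hz, -, -, hexp⟩ | ⟨hn, -⟩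
      · refine ⟨z, hz, ForLoop.preserves Covers.pointUpdate _ _ _ hrest ?_⟩
        exact ForLoop.preserves Covers.explore _ _ _ hexp
          (Covers.of_mem (mem_insertFilter.2 (Or.inr rfl)))
      · exact absurd hx hn

/-- For every `ε > 0`, only finitely many iterations have `Θ(X k) < -ε` and `Θ(X k) < -σ k`. -/
theorem IsFrontDescentRun.eventually_not_lt (hrun : IsFrontDescentRun F p σ X L) (hm : 0 < m)
    (hF : ContDiff ℝ 1 F) (h₀ : MutuallyNondominated F (X 0)) {x₀ : Pt n} (hx₀ : x₀ ∈ X 0)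
    (hK : IsCompact (levelSet F x₀)) (horder : FirstMinimizesTheta F X L) {ε : ℝ} (hε : 0 < ε) :
    ∀ᶠ k in atTop, ¬ (Theta F (X k) < -ε ∧ Theta F (X k) < -σ k) := by
  have hnd := hrun.mutuallyNondominated h₀
  have hcov : ∀ k, Covers F x₀ (X k) := fun k => hrun.covers k.zero_le (Covers.of_mem hx₀)
  have hsub : ∀ k, X k ⊆ levelSet F x₀ := fun k x hx =>
    Set.mem_iUnion.2 ((hnd k).exists_le_of_covers hm (hcov k) hx)
  obtain ⟨η, hη, hdec⟩ := exists_refine_decrease hm hF p hK hε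
  choose x hx hΘ z hz hzc using fun k =>
    hrun.exists_first horder (k := k) ((hcov k).imp fun _ h => h.1)
  by_contra hcon
  obtain ⟨φ, hφ, hbad⟩ := extraction_of_frequently_atTop
    ((not_eventually.1 hcon).mono fun k hk => not_not.1 hk)
  obtain ⟨i, j, hij, hdist⟩ := exists_lt_dist_lt (hK.image hF.continuous)
    (u := fun i => F (x (φ i))) (fun i => Set.mem_image_of_mem F (hsub _ (hx _))) hη
  -- The refined point is covered from iteration `φ i + 1` on, hence at `φ j`.
  obtain ⟨l, hl⟩ := (hnd (φ j)).exists_le_of_covers hm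
    (hrun.covers (Nat.succ_le_of_lt (hφ hij)) (hzc (φ i))) (hx (φ j))
  have h1 := hdec _ (hsub _ (hx (φ i))) (z (φ i)) (σ (φ i)) (hΘ (φ i) ▸ (hbad i).1)
    (hΘ (φ i) ▸ (hbad i).2) (hz (φ i)) l
  have h2 := (dist_le_pi_dist (F (x (φ i))) (F (x (φ j))) l).trans_lt hdist
  rw [Real.dist_eq] at h2
  have h3 := (abs_lt.1 h2).2
  linarith

end Run

end FrontDescent

theorem mainTheorem1 {n m : ℕ} (hm : 0 < m)
    (F : FrontDescent.Pt n → Fin m → ℝ) (hF : ContDiff ℝ 1 F)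
    (p : FrontDescent.Params) (σ : ℕ → ℝ) (hσ : ∀ k, 0 ≤ σ k)
    (X : ℕ → Set (FrontDescent.Pt n)) (L : ℕ → List (FrontDescent.Pt n))
    (hX₀ : FrontDescent.MutuallyNondominated F (X 0))
    (x₀ : FrontDescent.Pt n) (hx₀ : x₀ ∈ X 0)
    (hcompact : IsCompact (FrontDescent.levelSet F x₀))
    (hrun : FrontDescent.IsFrontDescentRun F p σ X L)
    (horder : FrontDescent.FirstMinimizesTheta F X L) :
    (∀ s : ℝ, 0 < s → (∀ k, σ k = s) →
      ∃ K : ℕ, ∀ k, K ≤ k → -s ≤ FrontDescent.Theta F (X k)) ∧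
    (Filter.Tendsto σ Filter.atTop (nhds 0) →
      Filter.Tendsto (fun k => FrontDescent.Theta F (X k)) Filter.atTop (nhds 0)) := by
  constructor
  · intro s hs hσs
    obtain ⟨K, hK⟩ := Filter.eventually_atTop.1
      (hrun.eventually_not_lt hm hF hX₀ hx₀ hcompact horder hs)
    exact ⟨K, fun k hk => not_lt.1 fun h => hK k hk ⟨h, by rwa [hσs k]⟩⟩
  · intro hσ0
    refine Metric.tendsto_nhds.2 fun ε hε => ?_
    -- Once `σ k < ε / 2`, the bound `Θ < -(ε / 2)` already implies `Θ < -σ k`; halving yields the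
    -- strict inequality at the end.
    have hε2 := half_pos hε
    filter_upwards [hrun.eventually_not_lt hm hF hX₀ hx₀ hcompact horder hε2,
      hσ0.eventually_lt_const hε2] with k hk hσk
    have hne : (X k).Nonempty :=
      (hrun.covers k.zero_le (FrontDescent.Covers.of_mem hx₀)).imp fun _ h => h.1
    obtain ⟨x, -, hΘ, -⟩ := hrun.exists_first horder hne
    have h0 : FrontDescent.Theta F (X k) ≤ 0 := hΘ ▸ FrontDescent.theta_nonpos x
    have h1 : -(ε / 2) ≤ FrontDescent.Theta F (X k) :=
      not_lt.1 fun h => hk ⟨h, h.trans (neg_lt_neg hσk)⟩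
    rw [Real.dist_eq, sub_zero, abs_of_nonpos h0]
    linarith
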